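/- Let $R$ be a (commutative) Dedekind domain with field of fractions $K$, and let $G$ be a finite group acting on $R$ by ring automorphisms $\sigma_g$; extend $\sigma_g$ to $K$. Let $A=K\diamondsuit_{\sigma,\alpha}G$ be a crystalline graded ring: a ring containing $K$ as a subring (with the same $1$, not necessarily central), with elements $u_g\neq 0$ ($g\in G$), $g\mapsto u_g$ injective, $u_e=1$, such that $A=\bigoplus_{g\in G}Ku_g$ is a $G$-graded ring, each $Ku_g=u_gK$ is free of rank one as a left $K$-module with basis $u_g$, $u_g c=\sigma_g(c)u_g$ for $c\in K$, and, writing $u_gu_h=\alpha(g,h)u_{gh}$ with $\alpha(g,h)\in K$, $\alpha(g,g^{-1})c=0$ implies $c=0$ for all $g\in G$, $c\in K$. A full $R$-lattice in $A$ is an $R$-sub-bimodule $M\subset A$ that is finitely generated as a left and as a right $R$-module and satisfies $KM=A=MK$. A subset $T\subset A$ is graded if $\sum_g x_gu_g\in T$ (with $x_g\in K$) implies $x_gu_g\in T$ for every $g$. A gr-order is a graded full $R$-lattice that is a subring of $A$ containing $1_A$; a gr-maximal order is a gr-order that is maximal, with respect to inclusion, among the gr-orders in $A$. A two-sided graded Ideal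 in a gr-order $\Lambda$ is a two-sided ideal of $\Lambda$ that is a graded full $R$-lattice in $A$. A gr-prime Ideal of $\Lambda$ is a two-sided graded Ideal $P\neq\Lambda$ in $\Lambda$ such that for all two-sided graded Ideals $S,T$ in $\Lambda$, $ST\subset P$ implies $S\subset P$ or $T\subset P$. Products $MN$ are additive subgroups generated by the products $mn$, and for an additive subgroup $M\subset A$ we put $M^{-1}=\{x\in A\mid MxM\subset M\}$. Let $\Lambda$ be a gr-maximal order in $A$. Then for every two-sided graded Ideal $M$ in $\Lambda$ $$MM^{-1}=M^{-1}M=\Lambda,\qquad (M^{-1})^{-1}=M.$$ Furthermore, every two-sided graded Ideal in $\Lambda$ is a product of finitely many gr-prime Ideals of $\Lambda$ (the empty product being $\Lambda$), uniquely up to the order of the factors, and $PQ=QP$ for all gr-prime Ideals $P,Q$ of $\Lambda$. -/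

import Mathlib

open scoped Pointwise

/-- A crystalline graded ring `A = K ◇_{σ,α} G` over the field `K`, where the finite group `G` acts
on a domain `R` with field of fractions `K` and `σ` is the extension of that action to `K`.
The field `K` is embedded in `A` by `ι`, in general not centrally. -/
structure CrystallineGradedRing (R K G A : Type*) [CommRing R] [Field K] [Algebra R K]
    [Group G] [Fintype G] [MulSemiringAction G R] [Ring A] where
  /-- the inclusion of `K` in `A` -/
  ι : K →+* A
  /-- the elements `u_g` -/
  u : G → A
  u_injective : Function.Injective u
  u_ne_zero : ∀ g, u g ≠ 0
  u_one : u 1 = 1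
  /-- `A = ⨁ K u_g`, where each `K u_g` is free of rank one with basis `u_g`. -/
  existsUnique_coeff : ∀ a : A, ∃! c : G → K, ∑ g, ι (c g) * u g = a
  /-- `K u_g = u_g K`. -/
  range_eq : ∀ g, Set.range (fun c : K => ι c * u g) = Set.range (fun c : K => u g * ι c)
  /-- `(K u_g) (K u_h) ⊆ K u_{gh}`. -/
  graded_mul : ∀ (g h : G) (a b : K), ∃ c : K, (ι a * u g) * (ι b * u h) = ι c * u (g * h)
  /-- No torsion: `α(g, g⁻¹) c = 0` only for `c = 0`, where `α(g, g⁻¹) = u_g u_{g⁻¹}`. -/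
  torsionFree : ∀ (g : G) (c : K), u g * u g⁻¹ * ι c = 0 → c = 0
  /-- `u_g r = σ_g(r) u_g`, where `σ` is the given action of `G` on `R`. -/
  u_mul : ∀ (g : G) (r : R),
    u g * ι (algebraMap R K r) = ι (algebraMap R K (g • r)) * u g

namespace CrystallineGradedRing

variable {R K G A : Type*} [CommRing R] [Field K] [Algebra R K]
  [Group G] [Fintype G] [MulSemiringAction G R] [Ring A]

/-- `T ⊆ A` is graded if it contains the homogeneous components of each of its elements. -/
def IsGraded (D : CrystallineGradedRing R K G A) (T : AddSubgroup A) : Prop :=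
  ∀ c : G → K, ∑ g, D.ι (c g) * D.u g ∈ T → ∀ g, D.ι (c g) * D.u g ∈ T

/-- `R`-lattices in `A`: `R`-sub-bimodules that are finitely generated both as left and as right
`R`-modules. They are automatically torsion-free, since nonzero elements of `R` are units of `A`,
and `R^G` automatically acts the same way on both sides, since it is central in `A`. -/
structure IsLattice (D : CrystallineGradedRing R K G A) (M : AddSubgroup A) : Prop where
  left_mem : ∀ (r : R), ∀ m ∈ M, D.ι (algebraMap R K r) * m ∈ M
  right_mem : ∀ (r : R), ∀ m ∈ M, m * D.ι (algebraMap R K r) ∈ M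
  left_fg : ∃ S : Finset A,
    AddSubgroup.closure {x | ∃ r : R, ∃ s ∈ S, x = D.ι (algebraMap R K r) * s} = M
  right_fg : ∃ S : Finset A,
    AddSubgroup.closure {x | ∃ r : R, ∃ s ∈ S, x = s * D.ι (algebraMap R K r)} = M

/-- Full lattices: `K M = A = M K`. -/
structure IsFullLattice (D : CrystallineGradedRing R K G A) (M : AddSubgroup A) : Prop
    extends D.IsLattice M where
  left_full : AddSubgroup.closure {x | ∃ k : K, ∃ m ∈ M, x = D.ι k * m} = ⊤
  right_full : AddSubgroup.closure {x | ∃ k : K, ∃ m ∈ M, x = m * D.ι k} = ⊤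

/-- Graded orders in `A`: graded full lattices that are subrings with the same identity as `A`. -/
structure IsGrOrder (D : CrystallineGradedRing R K G A) (Λ : AddSubgroup A) : Prop
    extends D.IsFullLattice Λ where
  graded : D.IsGraded Λ
  one_mem : (1 : A) ∈ Λ
  mul_mem : ∀ x ∈ Λ, ∀ y ∈ Λ, x * y ∈ Λ

/-- gr-maximal orders: graded orders that are maximal among the graded orders. -/
def IsGrMaximalOrder (D : CrystallineGradedRing R K G A) (Λ : AddSubgroup A) : Prop :=
  Maximal D.IsGrOrder Λ

/-- Two-sided graded Ideals in `Λ`: two-sided ideals of `Λ` that are graded full lattices in `A`. -/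
structure IsTwoSidedGrIdeal (D : CrystallineGradedRing R K G A) (Λ M : AddSubgroup A) : Prop
    extends D.IsFullLattice M where
  graded : D.IsGraded M
  le : M ≤ Λ
  mul_mem_left : ∀ x ∈ Λ, ∀ m ∈ M, x * m ∈ M
  mul_mem_right : ∀ x ∈ Λ, ∀ m ∈ M, m * x ∈ M

/-- gr-prime Ideals of `Λ`. -/
structure IsGrPrime (D : CrystallineGradedRing R K G A) (Λ P : AddSubgroup A) : Prop
    extends D.IsTwoSidedGrIdeal Λ P where
  ne_self : P ≠ Λ
  le_or_le : ∀ S T : AddSubgroup A, D.IsTwoSidedGrIdeal Λ S → D.IsTwoSidedGrIdeal Λ T →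
    S * T ≤ P → S ≤ P ∨ T ≤ P

end CrystallineGradedRing

/-- `M⁻¹ = {x ∈ A | M x M ⊆ M}`. -/
def latticeInv {A : Type*} [Ring A] (M : AddSubgroup A) : AddSubgroup A where
  carrier := {x | ∀ m ∈ M, ∀ n ∈ M, m * x * n ∈ M}
  zero_mem' := fun m _ n _ => by simp [M.zero_mem]
  add_mem' := fun {x y} hx hy m hm n hn => by
    rw [mul_add, add_mul]
    exact M.add_mem (hx m hm n hn) (hy m hm n hn)
  neg_mem' := fun {x} hx m hm n hn => by
    rw [mul_neg, neg_mul]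
    exact M.neg_mem (hx m hm n hn)

/-- The product of a list of ideals of `Λ`, the empty product being `Λ`. -/
def idealProd {A : Type*} [Ring A] (Λ : AddSubgroup A) (l : List (AddSubgroup A)) :
    AddSubgroup A :=
  l.foldr (fun P N => P * N) Λ

/-!
Maximality of `Λ` forces `{x | x N ⊆ N} = Λ = {x | N x ⊆ N}` for every graded fractional ideal `N`,
so `N⁻¹` is both the left and the right residual of `Λ` by `N`, and the formal theory of the closure
`N ↦ (N⁻¹)⁻¹` is available. Chain conditions on the quotients of `Λ` come from `R`: products over
`G`-orbits are central in `A`, so every two-sided graded Ideal contains a central non-zero-divisor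
of `R`, modulo which `Λ` is Artinian because `R` is Noetherian of dimension at most one.

A gr-prime Ideal `P` is maximal: suppose `P < S`, let `L` be minimal among the graded left ideals
strictly containing `P`, and `N` minimal among those containing `P` with `S + N = Λ`. For
homogeneous `x ∈ L` with `N x ⊄ P`, minimality of `L` gives `N x + P = L = S L + P = S N x + P`, so
`N = (S ∩ N) + {n ∈ N | n x ∈ P}`, whence `N x ⊆ P` by minimality of `N`. Thus `N L ⊆ P`, so
`N ⊆ P ⊆ S` and `S = Λ`.

An Ideal `I` that is maximal subject to `(I⁻¹)⁻¹ ⊆ P` is reflexive and gr-prime, hence `I = P`.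
So the gr-primes are reflexive, and `M⁻¹ ⊄ Λ` for every proper Ideal `M`. Applied to `N N⁻¹` and
`N⁻¹ N`, this makes the graded fractional ideals a group, and containment becomes divisibility.
-/

section AddSubgroup

variable {A : Type*} [Ring A] {M N L : AddSubgroup A}

instance addSubgroupSemigroup : Semigroup (AddSubgroup A) where
  mul_assoc M N L := AddSubgroup.toAddSubmonoid_injective <| by
    simp only [AddSubgroup.mul_toAddSubmonoid, mul_assoc]

theorem addSubgroup_mul_le : M * N ≤ L ↔ ∀ m ∈ M, ∀ n ∈ N, m * n ∈ L :=
  AddSubmonoid.mul_le (M := M.toAddSubmonoid) (N := N.toAddSubmonoid) (P := L.toAddSubmonoid)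

theorem mul_mem_addSubgroup_mul {m n : A} (hm : m ∈ M) (hn : n ∈ N) : m * n ∈ M * N :=
  addSubgroup_mul_le.1 le_rfl m hm n hn

instance addSubgroupMulLeftMono : MulLeftMono (AddSubgroup A) where
  elim _ _ _ h := addSubgroup_mul_le.2 fun _ hm _ hn => mul_mem_addSubgroup_mul hm (h hn)

instance addSubgroupMulRightMono : MulRightMono (AddSubgroup A) where
  elim _ _ _ h := addSubgroup_mul_le.2 fun _ hm _ hn => mul_mem_addSubgroup_mul (h hm) hn

/-- The residual `{x | x M ⊆ L}` of `L` by `M` among left multipliers. -/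
def leftResidual (M L : AddSubgroup A) : AddSubgroup A where
  carrier := {x | ∀ m ∈ M, x * m ∈ L}
  zero_mem' m _ := by simp
  add_mem' hx hy m hm := by rw [add_mul]; exact L.add_mem (hx m hm) (hy m hm)
  neg_mem' hx m hm := by rw [neg_mul]; exact L.neg_mem (hx m hm)

/-- The residual `{x | M x ⊆ L}` of `L` by `M` among right multipliers. -/
def rightResidual (M L : AddSubgroup A) : AddSubgroup A where
  carrier := {x | ∀ m ∈ M, m * x ∈ L}
  zero_mem' m _ := by simp
  add_mem' hx hy m hm := by rw [mul_add]; exact L.add_mem (hx m hm) (hy m hm)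
  neg_mem' hx m hm := by rw [mul_neg]; exact L.neg_mem (hx m hm)

theorem le_leftResidual_iff : N ≤ leftResidual M L ↔ N * M ≤ L :=
  addSubgroup_mul_le.symm

theorem le_rightResidual_iff : N ≤ rightResidual M L ↔ M * N ≤ L :=
  addSubgroup_mul_le.trans forall₂_comm |>.symm

theorem leftResidual_mul_le : leftResidual M L * M ≤ L := le_leftResidual_iff.1 le_rfl

theorem mul_rightResidual_le : M * rightResidual M L ≤ L := le_rightResidual_iff.1 le_rfl

theorem addSubgroup_sup_mul_le {N' : AddSubgroup A} (h : M * L ≤ N') (h' : N * L ≤ N') :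
    (M ⊔ N) * L ≤ N' :=
  le_leftResidual_iff.1 (sup_le (le_leftResidual_iff.2 h) (le_leftResidual_iff.2 h'))

theorem addSubgroup_mul_sup_le {N' : AddSubgroup A} (h : M * N ≤ N') (h' : M * L ≤ N') :
    M * (N ⊔ L) ≤ N' :=
  le_rightResidual_iff.1 (sup_le (le_rightResidual_iff.2 h) (le_rightResidual_iff.2 h'))

theorem latticeInv_eq_leftResidual : latticeInv M = leftResidual M (rightResidual M M) := by
  ext x
  exact ⟨fun h m hm n hn => by simpa only [mul_assoc] using h n hn m hm,
    fun h m hm n hn => by simpa only [mul_assoc] using h n hn m hm⟩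

theorem latticeInv_eq_rightResidual : latticeInv M = rightResidual M (leftResidual M M) := rfl

theorem le_sup_inf_comap_mulRight {S P : AddSubgroup A} {x : A}
    (hSN : S * N ≤ S ⊓ N) (hSP : S * P ≤ P) (hNL : N.map (AddMonoidHom.mulRight x) ⊔ P = L)
    (hSL : S * L ⊔ P = L) : N ≤ S ⊔ N ⊓ P.comap (AddMonoidHom.mulRight x) := by
  intro n hn
  have mul_map_le : S * N.map (AddMonoidHom.mulRight x) ≤
      (S * N).map (AddMonoidHom.mulRight x) := by
    rw [addSubgroup_mul_le]
    rintro s hs _ ⟨n, hn, rfl⟩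
    exact ⟨s * n, mul_mem_addSubgroup_mul hs hn, mul_assoc s n x⟩
  have hL : L ≤ (S * N).map (AddMonoidHom.mulRight x) ⊔ P := by
    rw [← hSL, ← hNL]
    exact sup_le (addSubgroup_mul_sup_le (mul_map_le.trans le_sup_left) (hSP.trans le_sup_right))
      le_sup_right
  have hnx : n * x ∈ L := hNL ▸ AddSubgroup.mem_sup_left ⟨n, hn, rfl⟩
  obtain ⟨_, ⟨s, hs, rfl⟩, p, hp, h⟩ := AddSubgroup.mem_sup.1 (hL hnx)
  obtain ⟨hsS, hsN⟩ := hSN hs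
  refine AddSubgroup.mem_sup.2 ⟨s, hsS, n - s, ⟨N.sub_mem hn hsN, ?_⟩, add_sub_cancel s n⟩
  change (n - s) * x ∈ P
  rw [sub_mul, ← h]
  exact (add_sub_cancel_left (s * x) p).symm ▸ hp

end AddSubgroup

section Module

open nonZeroDivisors

variable {R V : Type*} [CommRing R] [AddCommGroup V] [Module R V]

theorem closure_smul_eq_span (S : Set V) :
    AddSubgroup.closure {x | ∃ r : R, ∃ s ∈ S, x = r • s} = (Submodule.span R S).toAddSubgroup := by
  set C := AddSubgroup.closure {x | ∃ r : R, ∃ s ∈ S, x = r • s}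
  have smul_mem (a : R) : C ≤ C.comap (DistribSMul.toAddMonoidHom V a) := by
    rw [AddSubgroup.closure_le]
    rintro _ ⟨r, s, hs, rfl⟩
    exact AddSubgroup.subset_closure ⟨a * r, s, hs, smul_smul a r s⟩
  apply le_antisymm
  · rw [AddSubgroup.closure_le]
    rintro _ ⟨r, s, hs, rfl⟩
    exact Submodule.smul_mem _ r (Submodule.subset_span hs)
  · have hS : S ⊆ C := fun s hs => AddSubgroup.subset_closure ⟨1, s, hs, (one_smul R s).symm⟩
    have span_le : Submodule.span R S ≤ { C with smul_mem' := fun a x hx => smul_mem a hx } :=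
      Submodule.span_le.2 hS
    exact span_le

theorem exists_finset_closure_smul_eq_iff_fg {N : Submodule R V} :
    (∃ S : Finset V, AddSubgroup.closure {x | ∃ r : R, ∃ s ∈ S, x = r • s} = N.toAddSubgroup) ↔
      N.FG :=
  exists_congr fun S => by
    rw [← Submodule.toAddSubgroup_inj, ← closure_smul_eq_span]; rfl

theorem fg_of_map_le_of_injective [IsNoetherianRing R] {V' : Type*} [AddCommGroup V'] [Module R V']
    {N : Submodule R V} {N' : Submodule R V'} (hN' : N'.FG) (f : V →ₗ[R] V')
    (hf : Function.Injective f) (h : N.map f ≤ N') : N.FG :=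
  have := isNoetherian_of_fg_of_noetherian N' hN'
  Submodule.fg_of_fg_map_injective f hf (isNoetherian_submodule.1 this _ h)

theorem exists_maximal_submodule_of_fg [IsNoetherianRing R] {N : Submodule R V} (hN : N.FG)
    {p : Submodule R V → Prop} (hp : ∀ L, p L → L ≤ N) (hne : ∃ L, p L) : ∃ L, Maximal p L := by
  have := isNoetherian_of_fg_of_noetherian N hN
  have : WellFoundedGT (Set.Iic N) := (Submodule.mapIic N).symm.strictMono.wellFoundedGT
  obtain ⟨L₀, hL₀⟩ := hne
  obtain ⟨L, hL, hmax⟩ :=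
    exists_maximal_of_wellFoundedGT (fun L : Set.Iic N => p L) ⟨⟨L₀, hp L₀ hL₀⟩, hL₀⟩
  exact ⟨L, hL, fun L' hL' => hmax (y := ⟨L', hp L' hL'⟩) hL'⟩

theorem isArtinian_of_smul_eq_zero [IsNoetherianRing R] [Ring.KrullDimLE 1 R] [Module.Finite R V]
    {r : R} (hr : r ∈ R⁰) (h : ∀ v : V, r • v = 0) : IsArtinian R V := by
  have hV : Module.IsTorsionBySet R V (Ideal.span {r} : Ideal R) :=
    (Module.isTorsionBySet_span_singleton_iff r).2 h
  let := hV.module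
  have := hV.isScalarTower (S := R)
  have : IsArtinian R (R ⧸ Ideal.span {r}) :=
    (isFiniteLength_iff_isNoetherian_isArtinian.1 (isFiniteLength_quotient_span_singleton R hr)).2
  have : IsArtinianRing (R ⧸ Ideal.span {r}) := isArtinian_of_tower R this
  have : Module.Finite (R ⧸ Ideal.span {r}) V := Module.Finite.of_restrictScalars_finite R _ V
  exact isArtinian_of_surjective_algebraMap (Ideal.Quotient.mk_surjective (I := Ideal.span {r}))

theorem exists_minimal_submodule_of_smul_mem [IsNoetherianRing R] [Ring.KrullDimLE 1 R]
    {P N : Submodule R V} (hN : N.FG) {r : R} (hr : r ∈ R⁰) (h : ∀ v ∈ N, r • v ∈ P)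
    {p : Submodule R V → Prop} (hp : ∀ L, p L → P ≤ L ∧ L ≤ N) (hne : ∃ L, p L) :
    ∃ L, Minimal p L := by
  have := Module.Finite.iff_fg.2 hN
  have : IsArtinian R (N ⧸ P.comap N.subtype) :=
    isArtinian_of_smul_eq_zero hr fun v => by
      induction v using Submodule.Quotient.induction_on with
      | _ v => exact (Submodule.Quotient.mk_eq_zero _).2 (h v v.2)
  have : WellFoundedLT (Set.Ici (P.comap N.subtype)) :=
    (Submodule.comapMkQRelIso (P.comap N.subtype)).symm.strictMono.wellFoundedLT
  let toIci (L : Set.Icc P N) : Set.Ici (P.comap N.subtype) :=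
    ⟨L.1.comap N.subtype, Submodule.comap_mono L.2.1⟩
  have strictMono_toIci : StrictMono toIci := fun L L' hlt => lt_of_le_not_ge
    (Submodule.comap_mono hlt.le) fun hle => hlt.not_ge fun x hx => hle (x := ⟨x, L'.2.2 hx⟩) hx
  have := strictMono_toIci.wellFoundedLT
  obtain ⟨L₀, hL₀⟩ := hne
  obtain ⟨L, hL, hmin⟩ :=
    exists_minimal_of_wellFoundedLT (fun L : Set.Icc P N => p L) ⟨⟨L₀, hp L₀ hL₀⟩, hL₀⟩
  exact ⟨L, hL, fun L' hL' => hmin (y := ⟨L', hp L' hL'⟩) hL'⟩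

end Module

namespace CrystallineGradedRing

open nonZeroDivisors

variable {R K G A : Type*} [CommRing R] [Field K] [Algebra R K]
  [Group G] [Fintype G] [MulSemiringAction G R] [Ring A]

section Grading

variable (D : CrystallineGradedRing R K G A)

/-- The structure map `R → K → A`. -/
def φ : R →+* A := D.ι.comp (algebraMap R K)

theorem φ_apply (r : R) : D.φ r = D.ι (algebraMap R K r) := rfl

/-- The coefficients of `a : A` in the basis `u`. -/
noncomputable def coeff (a : A) : G → K := (D.existsUnique_coeff a).choose

theorem sum_coeff (a : A) : ∑ g, D.ι (D.coeff a g) * D.u g = a :=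
  (D.existsUnique_coeff a).choose_spec.1

theorem coeff_eq {a : A} {c : G → K} (h : ∑ g, D.ι (c g) * D.u g = a) : D.coeff a = c :=
  ((D.existsUnique_coeff a).choose_spec.2 c h).symm

/-- The projection of `A` onto its homogeneous component `K u_g`. -/
noncomputable def proj (g : G) : A →+ A where
  toFun a := D.ι (D.coeff a g) * D.u g
  map_zero' := by rw [D.coeff_eq (c := 0) (by simp)]; simp
  map_add' a b := by
    rw [D.coeff_eq (a := a + b) (c := D.coeff a + D.coeff b)
      (by simp [add_mul, Finset.sum_add_distrib, sum_coeff]), Pi.add_apply, map_add, add_mul]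

theorem proj_apply (g : G) (a : A) : D.proj g a = D.ι (D.coeff a g) * D.u g := rfl

theorem sum_proj (a : A) : ∑ g, D.proj g a = a := D.sum_coeff a

theorem proj_ι_mul_u_self (g : G) (c : K) : D.proj g (D.ι c * D.u g) = D.ι c * D.u g := by
  classical
  rw [proj_apply, D.coeff_eq (c := Pi.single g c), Pi.single_eq_same]
  rw [Finset.sum_eq_single g] <;> simp +contextual

theorem proj_ι_mul_u_of_ne {g h : G} (hgh : g ≠ h) (c : K) : D.proj g (D.ι c * D.u h) = 0 := by
  classical
  rw [proj_apply, D.coeff_eq (c := Pi.single h c), Pi.single_eq_of_ne hgh, map_zero, zero_mul]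
  rw [Finset.sum_eq_single h] <;> simp +contextual

theorem proj_mul_self (g h : G) (a b : A) :
    D.proj (g * h) (D.proj g a * D.proj h b) = D.proj g a * D.proj h b := by
  obtain ⟨c, hc⟩ := D.graded_mul g h (D.coeff a g) (D.coeff b h)
  rw [D.proj_apply g, D.proj_apply h, hc, proj_ι_mul_u_self]

theorem proj_mul_of_ne {g h k : G} (hk : k ≠ g * h) (a b : A) :
    D.proj k (D.proj g a * D.proj h b) = 0 := by
  obtain ⟨c, hc⟩ := D.graded_mul g h (D.coeff a g) (D.coeff b h)
  rw [D.proj_apply g, D.proj_apply h, hc, D.proj_ι_mul_u_of_ne hk]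

theorem proj_mul_proj (g h : G) (a b : A) :
    D.proj (g * h) (a * D.proj h b) = D.proj g a * D.proj h b := by
  conv_lhs => rw [← D.sum_proj a, Finset.sum_mul, map_sum]
  rw [Finset.sum_eq_single g, proj_mul_self]
  · exact fun k _ hk => D.proj_mul_of_ne (by simpa using hk.symm) a b
  · simp

theorem proj_proj_mul (g h : G) (a b : A) :
    D.proj (g * h) (D.proj g a * b) = D.proj g a * D.proj h b := by
  conv_lhs => rw [← D.sum_proj b, Finset.mul_sum, map_sum]
  rw [Finset.sum_eq_single h, proj_mul_self]
  · exact fun k _ hk => D.proj_mul_of_ne (by simpa using hk.symm) a b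
  · simp

theorem proj_mul (k : G) (a b : A) :
    D.proj k (a * b) = ∑ g, D.proj g a * D.proj (g⁻¹ * k) b := by
  conv_lhs => rw [← D.sum_proj a, Finset.sum_mul, map_sum]
  refine Finset.sum_congr rfl fun g _ => ?_
  rw [← proj_proj_mul, mul_inv_cancel_left]

theorem proj_one_φ (r : R) : D.proj 1 (D.φ r) = D.φ r := by
  simpa only [D.u_one, mul_one, φ_apply] using D.proj_ι_mul_u_self 1 (algebraMap R K r)

theorem proj_φ_mul (g : G) (r : R) (a : A) : D.proj g (D.φ r * a) = D.φ r * D.proj g a := by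
  simpa only [one_mul, proj_one_φ] using D.proj_proj_mul 1 g (D.φ r) a

theorem proj_mul_φ (g : G) (r : R) (a : A) : D.proj g a * D.φ r = D.φ (g • r) * D.proj g a := by
  simp only [proj_apply, φ_apply]
  rw [mul_assoc, D.u_mul, ← mul_assoc, ← mul_assoc, ← map_mul, mul_comm, map_mul]

variable {D} {M N T : AddSubgroup A}

theorem isGraded_iff : D.IsGraded T ↔ ∀ g, T ≤ T.comap (D.proj g) := by
  refine ⟨fun h g x hx => h (D.coeff x) (by rwa [sum_coeff]) g, fun h c hc g => ?_⟩
  simpa only [AddSubgroup.mem_comap, proj_apply, D.coeff_eq rfl] using h g hc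

theorem IsGraded.proj_mem (h : D.IsGraded T) (g : G) {x : A} (hx : x ∈ T) : D.proj g x ∈ T :=
  isGraded_iff.1 h g hx

theorem mem_of_proj_mem (D : CrystallineGradedRing R K G A) {x : A} (h : ∀ g, D.proj g x ∈ T) :
    x ∈ T :=
  D.sum_proj x ▸ sum_mem fun g _ => h g

theorem IsGraded.mul (hM : D.IsGraded M) (hN : D.IsGraded N) : D.IsGraded (M * N) := by
  refine isGraded_iff.2 fun k => addSubgroup_mul_le.2 fun m hm n hn => ?_
  rw [AddSubgroup.mem_comap, proj_mul]
  exact sum_mem fun g _ => mul_mem_addSubgroup_mul (hM.proj_mem g hm) (hN.proj_mem _ hn)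

theorem IsGraded.sup (hM : D.IsGraded M) (hN : D.IsGraded N) : D.IsGraded (M ⊔ N) :=
  isGraded_iff.2 fun g => sup_le ((isGraded_iff.1 hM g).trans (AddSubgroup.comap_mono le_sup_left))
    ((isGraded_iff.1 hN g).trans (AddSubgroup.comap_mono le_sup_right))

theorem IsGraded.inf (hM : D.IsGraded M) (hN : D.IsGraded N) : D.IsGraded (M ⊓ N) :=
  isGraded_iff.2 fun g _ hx => ⟨hM.proj_mem g hx.1, hN.proj_mem g hx.2⟩

theorem IsGraded.leftResidual (hM : D.IsGraded M) (hN : D.IsGraded N) :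
    D.IsGraded (leftResidual M N) := by
  refine isGraded_iff.2 fun g x hx m hm => D.mem_of_proj_mem fun k => ?_
  have h := hN.proj_mem k (hx _ (hM.proj_mem (g⁻¹ * k) hm))
  have hl := D.proj_mul_proj g (g⁻¹ * k) x m
  have hr := D.proj_proj_mul g (g⁻¹ * k) x m
  rw [mul_inv_cancel_left] at hl hr
  rwa [hr, ← hl]

theorem IsGraded.rightResidual (hM : D.IsGraded M) (hN : D.IsGraded N) :
    D.IsGraded (rightResidual M N) := by
  refine isGraded_iff.2 fun g x hx m hm => D.mem_of_proj_mem fun k => ?_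
  have h := hN.proj_mem k (hx _ (hM.proj_mem (k * g⁻¹) hm))
  have hl := D.proj_mul_proj (k * g⁻¹) g m x
  have hr := D.proj_proj_mul (k * g⁻¹) g m x
  rw [inv_mul_cancel_right] at hl hr
  rwa [hl, ← hr]

theorem IsGraded.map_mulRight_proj (hM : D.IsGraded M) (g : G) (x : A) :
    D.IsGraded (M.map (AddMonoidHom.mulRight (D.proj g x))) := by
  rw [isGraded_iff]
  rintro k _ ⟨m, hm, rfl⟩
  have h := D.proj_mul_proj (k * g⁻¹) g m x
  rw [inv_mul_cancel_right] at h
  exact ⟨_, hM.proj_mem (k * g⁻¹) hm, h.symm⟩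

theorem IsGraded.comap_mulRight_proj (hM : D.IsGraded M) (g : G) (x : A) :
    D.IsGraded (M.comap (AddMonoidHom.mulRight (D.proj g x))) :=
  isGraded_iff.2 fun k m hm => by
    have h := hM.proj_mem (k * g) hm
    rwa [AddMonoidHom.coe_mulRight, proj_mul_proj] at h

theorem IsGraded.map_mulLeft_φ (hM : D.IsGraded M) (r : R) :
    D.IsGraded (M.map (AddMonoidHom.mulLeft (D.φ r))) := by
  rw [isGraded_iff]
  rintro g _ ⟨m, hm, rfl⟩
  exact ⟨_, hM.proj_mem g hm, (D.proj_φ_mul g r m).symm⟩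

end Grading

section InvariantScalars

variable (D : CrystallineGradedRing R K G A)

/-- The images in `A` of the `G`-invariant non-zero-divisors of `R`. They are central in `A`, and
inverting them suffices to turn `R` into `K`, so they serve as common denominators. -/
def invariantScalars : Submonoid A := (R⁰ ⊓ FixedPoints.submonoid G R).map D.φ

theorem invariantScalars_le_center : D.invariantScalars ≤ Submonoid.center A := by
  rintro _ ⟨r, ⟨-, hr⟩, rfl⟩
  refine Submonoid.mem_center_iff.2 fun a => ?_
  change a * D.φ r = D.φ r * a
  rw [← D.sum_proj a, Finset.mul_sum, Finset.sum_mul]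
  exact Finset.sum_congr rfl fun g _ => by rw [proj_mul_φ, hr g]

theorem exists_φ_mul_mem_invariantScalars {r : R} (hr : r ∈ R⁰) :
    ∃ s : R, D.φ (s * r) ∈ D.invariantScalars := by
  classical
  obtain ⟨s, hs⟩ : r ∣ ∏ g : G, g • r := by
    simpa only [one_smul] using
      Finset.dvd_prod_of_mem (fun g : G => g • r) (Finset.mem_univ 1)
  refine ⟨s, mul_comm r s ▸ hs ▸ Submonoid.mem_map_of_mem D.φ ⟨prod_mem fun g _ => ?_, fun g => ?_⟩⟩
  · rw [← MulEquivClass.map_nonZeroDivisors (MulSemiringAction.toRingEquiv G R g)]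
    exact Submonoid.mem_map_of_mem _ hr
  · rw [Finset.smul_prod']
    simp only [smul_smul]
    exact Fintype.prod_equiv (Equiv.mulLeft g) _ _ fun _ => rfl

variable {D}

theorem isUnit_of_mem_invariantScalars [IsFractionRing R K] {z : A}
    (hz : z ∈ D.invariantScalars) : IsUnit z := by
  obtain ⟨r, ⟨hr, -⟩, rfl⟩ := hz
  exact (IsLocalization.map_units K (⟨r, hr⟩ : R⁰)).map D.ι

end InvariantScalars

section Lattice

/-- `A` as a left `R`-module. -/
abbrev leftModule (D : CrystallineGradedRing R K G A) : Module R A := Module.compHom A D.φ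

/-- `A` as a right `R`-module, written as a left one since `R` is commutative. -/
abbrev rightModule (D : CrystallineGradedRing R K G A) : Module R A :=
  Module.compHom A (D.φ.toOpposite fun r s => (Commute.all r s).map D.φ)

variable {D : CrystallineGradedRing R K G A} {M N : AddSubgroup A}

theorem IsLattice.invariantScalar_mul_mem (hM : D.IsLattice M) {z x : A}
    (hz : z ∈ D.invariantScalars) (hx : x ∈ M) : z * x ∈ M := by
  obtain ⟨r, -, rfl⟩ := hz
  exact hM.left_mem r x hx

theorem IsLattice.mul_mul_mem (hM : D.IsLattice M) {z w x : A} (hz : z ∈ D.invariantScalars)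
    (hw : w ∈ D.invariantScalars) (h : z * x ∈ M ∨ w * x ∈ M) : z * w * x ∈ M := by
  rcases h with h | h
  · rw [← Submonoid.mem_center_iff.1 (D.invariantScalars_le_center hz) w, mul_assoc]
    exact hM.invariantScalar_mul_mem hw h
  · rw [mul_assoc]
    exact hM.invariantScalar_mul_mem hz h

theorem IsFullLattice.exists_mul_mem [IsFractionRing R K] (hM : D.IsFullLattice M) (a : A) :
    ∃ z ∈ D.invariantScalars, z * a ∈ M := by
  have ha : a ∈ AddSubgroup.closure {x | ∃ k : K, ∃ m ∈ M, x = D.ι k * m} :=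
    hM.left_full ▸ AddSubgroup.mem_top a
  induction ha using AddSubgroup.closure_induction with
  | mem x hx =>
    obtain ⟨k, m, hm, rfl⟩ := hx
    obtain ⟨⟨r, s⟩, hk : k * algebraMap R K s = algebraMap R K r⟩ := IsLocalization.surj R⁰ k
    obtain ⟨t, ht⟩ := D.exists_φ_mul_mem_invariantScalars s.2
    refine ⟨_, ht, ?_⟩
    have clear_denominator : D.φ (t * s) * D.ι k = D.φ (t * r) := by
      rw [φ_apply, φ_apply, ← map_mul, map_mul (algebraMap R K) t, map_mul (algebraMap R K) t,
        mul_assoc, mul_comm _ k, hk]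
    rw [← mul_assoc, clear_denominator]
    exact hM.left_mem _ m hm
  | zero => exact ⟨1, one_mem _, by rw [mul_zero]; exact zero_mem M⟩
  | add x y _ _ hx hy =>
    obtain ⟨z, hz, hzx⟩ := hx
    obtain ⟨w, hw, hwy⟩ := hy
    refine ⟨z * w, mul_mem hz hw, ?_⟩
    rw [mul_add]
    exact add_mem (hM.mul_mul_mem hz hw (.inl hzx)) (hM.mul_mul_mem hz hw (.inr hwy))
  | neg x _ hx => exact hx.imp fun z hz => ⟨hz.1, mul_neg z x ▸ neg_mem hz.2⟩

theorem IsLattice.of_mul_mem [IsNoetherianRing R] [IsFractionRing R K] (hM : D.IsLattice M)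
    (left_mem : ∀ r : R, ∀ n ∈ N, D.φ r * n ∈ N) (right_mem : ∀ r : R, ∀ n ∈ N, n * D.φ r ∈ N)
    {w : A} (hw : w ∈ D.invariantScalars) (hwM : w ∈ leftResidual N M) : D.IsLattice N where
  left_mem := left_mem
  right_mem := right_mem
  left_fg := by
    let := D.leftModule
    let f : A →ₗ[R] A :=
      { AddMonoidHom.mulLeft w with
        map_smul' := fun r a => by
          change w * (D.φ r * a) = D.φ r * (w * a)
          rw [← mul_assoc, ← Submonoid.mem_center_iff.1 (D.invariantScalars_le_center hw),
            mul_assoc] }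
    have map_le : Submodule.map f { N with smul_mem' := left_mem } ≤
        { M with smul_mem' := hM.left_mem } := by
      rintro _ ⟨n, hn, rfl⟩
      exact hwM n hn
    exact exists_finset_closure_smul_eq_iff_fg.2 <| fg_of_map_le_of_injective
      (exists_finset_closure_smul_eq_iff_fg.1 hM.left_fg) f
      (isUnit_of_mem_invariantScalars hw).mul_right_injective map_le
  right_fg := by
    let := D.rightModule
    let f : A →ₗ[R] A :=
      { AddMonoidHom.mulLeft w with map_smul' := fun r a => (mul_assoc w a (D.φ r)).symm }
    have map_le : Submodule.map f { N with smul_mem' := right_mem } ≤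
        { M with smul_mem' := hM.right_mem } := by
      rintro _ ⟨n, hn, rfl⟩
      exact hwM n hn
    exact exists_finset_closure_smul_eq_iff_fg.2 <| fg_of_map_le_of_injective
      (exists_finset_closure_smul_eq_iff_fg.1 hM.right_fg) f
      (isUnit_of_mem_invariantScalars hw).mul_right_injective map_le

theorem IsFullLattice.of_mul_mem [IsNoetherianRing R] [IsFractionRing R K]
    (hM : D.IsFullLattice M) (left_mem : ∀ r : R, ∀ n ∈ N, D.φ r * n ∈ N)
    (right_mem : ∀ r : R, ∀ n ∈ N, n * D.φ r ∈ N) {z w : A} (hz : z ∈ D.invariantScalars)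
    (hzN : z ∈ leftResidual M N) (hw : w ∈ D.invariantScalars) (hwM : w ∈ leftResidual N M) :
    D.IsFullLattice N where
  toIsLattice := hM.toIsLattice.of_mul_mem left_mem right_mem hw hwM
  left_full := by
    rw [eq_top_iff, ← hM.left_full, AddSubgroup.closure_le]
    rintro _ ⟨k, m, hm, rfl⟩
    obtain ⟨r, ⟨hr, -⟩, rfl⟩ := hz
    have hr0 : algebraMap R K r ≠ 0 := (IsLocalization.map_units K (⟨r, hr⟩ : R⁰)).ne_zero
    refine AddSubgroup.subset_closure ⟨k * (algebraMap R K r)⁻¹, _, hzN m hm, ?_⟩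
    change _ = _ * (D.ι _ * m)
    rw [← mul_assoc, ← map_mul, inv_mul_cancel_right₀ hr0]
  right_full := by
    rw [eq_top_iff, ← hM.right_full, AddSubgroup.closure_le]
    rintro _ ⟨k, m, hm, rfl⟩
    have comm := Submonoid.mem_center_iff.1 (D.invariantScalars_le_center hz) m
    obtain ⟨r, ⟨hr, -⟩, rfl⟩ := hz
    have hr0 : algebraMap R K r ≠ 0 := (IsLocalization.map_units K (⟨r, hr⟩ : R⁰)).ne_zero
    refine AddSubgroup.subset_closure ⟨(algebraMap R K r)⁻¹ * k, _, hzN m hm, ?_⟩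
    rw [← comm, mul_assoc]
    change _ = m * (D.ι _ * _)
    rw [← map_mul, mul_inv_cancel_left₀ hr0]

end Lattice

section FractionalIdeal

/-- Two-sided graded fractional ideals of `Λ`: graded sub-bimodules of `A` that are commensurable
with `Λ` up to invariant scalars. Unlike two-sided graded Ideals they need not lie in `Λ`. -/
structure IsGrFractionalIdeal (D : CrystallineGradedRing R K G A) (Λ N : AddSubgroup A) :
    Prop where
  graded : D.IsGraded N
  mul_le_left : Λ * N ≤ N
  mul_le_right : N * Λ ≤ N
  exists_scalar_mem : ∃ z ∈ D.invariantScalars, z ∈ N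
  exists_scalar_mul_mem : ∃ z ∈ D.invariantScalars, z ∈ leftResidual N Λ

variable {D : CrystallineGradedRing R K G A} {Λ M N : AddSubgroup A}

theorem IsGrOrder.φ_mem (hΛ : D.IsGrOrder Λ) (r : R) : D.φ r ∈ Λ := by
  simpa only [φ_apply, mul_one] using hΛ.left_mem r 1 hΛ.one_mem

theorem IsGrOrder.mul_self_le (hΛ : D.IsGrOrder Λ) : Λ * Λ ≤ Λ :=
  addSubgroup_mul_le.2 hΛ.mul_mem

theorem IsGrOrder.le_mul_left (hΛ : D.IsGrOrder Λ) : N ≤ Λ * N := fun n hn =>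
  one_mul n ▸ mul_mem_addSubgroup_mul hΛ.one_mem hn

theorem IsGrOrder.le_mul_right (hΛ : D.IsGrOrder Λ) : N ≤ N * Λ := fun n hn =>
  mul_one n ▸ mul_mem_addSubgroup_mul hn hΛ.one_mem

theorem IsGrOrder.mul_self (hΛ : D.IsGrOrder Λ) : Λ * Λ = Λ :=
  hΛ.mul_self_le.antisymm hΛ.le_mul_left

theorem IsGrFractionalIdeal.order_mul (hN : D.IsGrFractionalIdeal Λ N) (hΛ : D.IsGrOrder Λ) :
    Λ * N = N :=
  hN.mul_le_left.antisymm hΛ.le_mul_left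

theorem IsGrFractionalIdeal.mul_order (hN : D.IsGrFractionalIdeal Λ N) (hΛ : D.IsGrOrder Λ) :
    N * Λ = N :=
  hN.mul_le_right.antisymm hΛ.le_mul_right

theorem IsGrFractionalIdeal.of_le (graded : D.IsGraded N) (mul_le_left : Λ * N ≤ N)
    (mul_le_right : N * Λ ≤ N) {z : A} (hz : z ∈ D.invariantScalars) (hzN : z ∈ N)
    (hle : N ≤ Λ) : D.IsGrFractionalIdeal Λ N where
  graded := graded
  mul_le_left := mul_le_left
  mul_le_right := mul_le_right
  exists_scalar_mem := ⟨z, hz, hzN⟩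
  exists_scalar_mul_mem := ⟨1, one_mem _, fun n hn => (one_mul n).symm ▸ hle hn⟩

theorem IsGrOrder.isGrFractionalIdeal (hΛ : D.IsGrOrder Λ) : D.IsGrFractionalIdeal Λ Λ :=
  .of_le hΛ.graded hΛ.mul_self_le hΛ.mul_self_le D.invariantScalars.one_mem hΛ.one_mem
    le_rfl

theorem IsGrFractionalIdeal.isFullLattice [IsNoetherianRing R] [IsFractionRing R K]
    (hN : D.IsGrFractionalIdeal Λ N) (hΛ : D.IsGrOrder Λ) : D.IsFullLattice N := by
  obtain ⟨z, hz, hzN⟩ := hN.exists_scalar_mem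
  obtain ⟨w, hw, hwN⟩ := hN.exists_scalar_mul_mem
  exact hΛ.toIsFullLattice.of_mul_mem
    (fun r n hn => addSubgroup_mul_le.1 hN.mul_le_left _ (hΛ.φ_mem r) n hn)
    (fun r n hn => addSubgroup_mul_le.1 hN.mul_le_right n hn _ (hΛ.φ_mem r))
    hz (addSubgroup_mul_le.1 hN.mul_le_right z hzN) hw hwN

theorem IsGrFractionalIdeal.isTwoSidedGrIdeal [IsNoetherianRing R] [IsFractionRing R K]
    (hN : D.IsGrFractionalIdeal Λ N) (hΛ : D.IsGrOrder Λ) (hle : N ≤ Λ) :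
    D.IsTwoSidedGrIdeal Λ N :=
  { hN.isFullLattice hΛ with
    graded := hN.graded
    le := hle
    mul_mem_left := addSubgroup_mul_le.1 hN.mul_le_left
    mul_mem_right := fun x hx n hn => addSubgroup_mul_le.1 hN.mul_le_right n hn x hx }

theorem IsTwoSidedGrIdeal.isGrFractionalIdeal [IsFractionRing R K]
    (hM : D.IsTwoSidedGrIdeal Λ M) : D.IsGrFractionalIdeal Λ M := by
  obtain ⟨z, hz, hzM⟩ := hM.toIsFullLattice.exists_mul_mem 1
  exact .of_le hM.graded (addSubgroup_mul_le.2 hM.mul_mem_left)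
    (addSubgroup_mul_le.2 fun m hm x hx => hM.mul_mem_right x hx m hm) hz (mul_one z ▸ hzM) hM.le

theorem IsGrFractionalIdeal.mul (hM : D.IsGrFractionalIdeal Λ M) (hN : D.IsGrFractionalIdeal Λ N)
    (hΛ : D.IsGrOrder Λ) : D.IsGrFractionalIdeal Λ (M * N) where
  graded := hM.graded.mul hN.graded
  mul_le_left := by rw [← mul_assoc, hM.order_mul hΛ]
  mul_le_right := by rw [mul_assoc, hN.mul_order hΛ]
  exists_scalar_mem := by
    obtain ⟨z, hz, hzM⟩ := hM.exists_scalar_mem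
    obtain ⟨w, hw, hwN⟩ := hN.exists_scalar_mem
    exact ⟨z * w, mul_mem hz hw, mul_mem_addSubgroup_mul hzM hwN⟩
  exists_scalar_mul_mem := by
    obtain ⟨z, hz, hzM⟩ := hM.exists_scalar_mul_mem
    obtain ⟨w, hw, hwN⟩ := hN.exists_scalar_mul_mem
    refine ⟨z * w, mul_mem hz hw, addSubgroup_mul_le (L := Λ.comap (AddMonoidHom.mulLeft _)).2
      fun m hm n hn => ?_⟩
    have rearrange : z * w * (m * n) = z * m * (w * n) := by
      rw [mul_assoc, ← mul_assoc w, ← Submonoid.mem_center_iff.1 (D.invariantScalars_le_center hw),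
        mul_assoc m, ← mul_assoc]
    change z * w * (m * n) ∈ Λ
    exact rearrange ▸ hΛ.mul_mem _ (hzM m hm) _ (hwN n hn)

theorem IsGrFractionalIdeal.leftResidual (hM : D.IsGrFractionalIdeal Λ M)
    (hN : D.IsGrFractionalIdeal Λ N) (hΛ : D.IsGrOrder Λ) :
    D.IsGrFractionalIdeal Λ (leftResidual M N) where
  graded := hM.graded.leftResidual hN.graded
  mul_le_left := by
    rw [le_leftResidual_iff, mul_assoc]
    exact (mul_le_mul_right leftResidual_mul_le Λ).trans hN.mul_le_left
  mul_le_right := by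
    rw [le_leftResidual_iff, mul_assoc, hM.order_mul hΛ]
    exact leftResidual_mul_le
  exists_scalar_mem := by
    obtain ⟨z, hz, hzN⟩ := hN.exists_scalar_mem
    obtain ⟨w, hw, hwM⟩ := hM.exists_scalar_mul_mem
    refine ⟨z * w, mul_mem hz hw, fun m hm => ?_⟩
    rw [mul_assoc]
    exact addSubgroup_mul_le.1 hN.mul_le_right z hzN _ (hwM m hm)
  exists_scalar_mul_mem := by
    obtain ⟨z, hz, hzN⟩ := hN.exists_scalar_mul_mem
    obtain ⟨w, hw, hwM⟩ := hM.exists_scalar_mem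
    refine ⟨z * w, mul_mem hz hw, fun x hx => ?_⟩
    rw [mul_assoc, ← Submonoid.mem_center_iff.1 (D.invariantScalars_le_center hw)]
    exact hzN _ (hx w hwM)

theorem IsGrFractionalIdeal.rightResidual (hM : D.IsGrFractionalIdeal Λ M)
    (hN : D.IsGrFractionalIdeal Λ N) (hΛ : D.IsGrOrder Λ) :
    D.IsGrFractionalIdeal Λ (rightResidual M N) where
  graded := hM.graded.rightResidual hN.graded
  mul_le_left := by
    rw [le_rightResidual_iff, ← mul_assoc, hM.mul_order hΛ]
    exact mul_rightResidual_le
  mul_le_right := by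
    rw [le_rightResidual_iff, ← mul_assoc]
    exact (mul_le_mul_left mul_rightResidual_le Λ).trans hN.mul_le_right
  exists_scalar_mem := by
    obtain ⟨z, hz, hzN⟩ := hN.exists_scalar_mem
    obtain ⟨w, hw, hwM⟩ := hM.exists_scalar_mul_mem
    refine ⟨w * z, mul_mem hw hz, fun m hm => ?_⟩
    rw [← mul_assoc, Submonoid.mem_center_iff.1 (D.invariantScalars_le_center hw)]
    exact addSubgroup_mul_le.1 hN.mul_le_left _ (hwM m hm) z hzN
  exists_scalar_mul_mem := by
    obtain ⟨z, hz, hzN⟩ := hN.exists_scalar_mul_mem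
    obtain ⟨w, hw, hwM⟩ := hM.exists_scalar_mem
    refine ⟨z * w, mul_mem hz hw, fun x hx => ?_⟩
    rw [mul_assoc]
    exact hzN _ (hx w hwM)

end FractionalIdeal

section MaximalOrder

variable {D : CrystallineGradedRing R K G A} {Λ M N : AddSubgroup A}

theorem IsGrMaximalOrder.isGrOrder (hΛ : D.IsGrMaximalOrder Λ) : D.IsGrOrder Λ := hΛ.prop

variable [IsNoetherianRing R] [IsFractionRing R K]

theorem IsGrMaximalOrder.eq_of_le (hΛ : D.IsGrMaximalOrder Λ) (hN : D.IsGrFractionalIdeal Λ N)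
    (hle : Λ ≤ N) (hmul : N * N ≤ N) : N = Λ :=
  (Maximal.eq_of_le hΛ { hN.isFullLattice hΛ.isGrOrder with
    graded := hN.graded
    one_mem := hle hΛ.isGrOrder.one_mem
    mul_mem := addSubgroup_mul_le.1 hmul } hle).symm

theorem IsGrMaximalOrder.leftResidual_self (hΛ : D.IsGrMaximalOrder Λ)
    (hM : D.IsGrFractionalIdeal Λ M) : leftResidual M M = Λ := by
  refine hΛ.eq_of_le (hM.leftResidual hM hΛ.isGrOrder) (le_leftResidual_iff.2 hM.mul_le_left) ?_
  rw [le_leftResidual_iff, mul_assoc]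
  exact (mul_le_mul_right leftResidual_mul_le _).trans leftResidual_mul_le

theorem IsGrMaximalOrder.rightResidual_self (hΛ : D.IsGrMaximalOrder Λ)
    (hM : D.IsGrFractionalIdeal Λ M) : rightResidual M M = Λ := by
  refine hΛ.eq_of_le (hM.rightResidual hM hΛ.isGrOrder) (le_rightResidual_iff.2 hM.mul_le_right) ?_
  rw [le_rightResidual_iff, ← mul_assoc]
  exact (mul_le_mul_left mul_rightResidual_le _).trans mul_rightResidual_le

theorem IsGrMaximalOrder.latticeInv_eq_leftResidual_order (hΛ : D.IsGrMaximalOrder Λ)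
    (hM : D.IsGrFractionalIdeal Λ M) : latticeInv M = leftResidual M Λ := by
  rw [latticeInv_eq_leftResidual, hΛ.rightResidual_self hM]

theorem IsGrMaximalOrder.latticeInv_eq_rightResidual_order (hΛ : D.IsGrMaximalOrder Λ)
    (hM : D.IsGrFractionalIdeal Λ M) : latticeInv M = rightResidual M Λ := by
  rw [latticeInv_eq_rightResidual, hΛ.leftResidual_self hM]

theorem IsGrMaximalOrder.le_latticeInv_iff_mul_le (hΛ : D.IsGrMaximalOrder Λ)
    (hM : D.IsGrFractionalIdeal Λ M) : N ≤ latticeInv M ↔ N * M ≤ Λ := by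
  rw [hΛ.latticeInv_eq_leftResidual_order hM, le_leftResidual_iff]

theorem IsGrMaximalOrder.le_latticeInv_iff_mul_le' (hΛ : D.IsGrMaximalOrder Λ)
    (hM : D.IsGrFractionalIdeal Λ M) : N ≤ latticeInv M ↔ M * N ≤ Λ := by
  rw [hΛ.latticeInv_eq_rightResidual_order hM, le_rightResidual_iff]

theorem IsGrMaximalOrder.mul_le_comm (hΛ : D.IsGrMaximalOrder Λ)
    (hM : D.IsGrFractionalIdeal Λ M) : M * N ≤ Λ ↔ N * M ≤ Λ :=
  (hΛ.le_latticeInv_iff_mul_le' hM).symm.trans (hΛ.le_latticeInv_iff_mul_le hM)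

theorem IsGrMaximalOrder.latticeInv_mul_le (hΛ : D.IsGrMaximalOrder Λ)
    (hM : D.IsGrFractionalIdeal Λ M) : latticeInv M * M ≤ Λ :=
  (hΛ.le_latticeInv_iff_mul_le hM).1 le_rfl

theorem IsGrMaximalOrder.mul_latticeInv_le (hΛ : D.IsGrMaximalOrder Λ)
    (hM : D.IsGrFractionalIdeal Λ M) : M * latticeInv M ≤ Λ :=
  (hΛ.le_latticeInv_iff_mul_le' hM).1 le_rfl

theorem IsGrMaximalOrder.isGrFractionalIdeal_latticeInv (hΛ : D.IsGrMaximalOrder Λ)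
    (hM : D.IsGrFractionalIdeal Λ M) : D.IsGrFractionalIdeal Λ (latticeInv M) := by
  rw [hΛ.latticeInv_eq_leftResidual_order hM]
  exact hM.leftResidual hΛ.isGrOrder.isGrFractionalIdeal hΛ.isGrOrder

theorem IsGrMaximalOrder.latticeInv_anti (hΛ : D.IsGrMaximalOrder Λ)
    (hM : D.IsGrFractionalIdeal Λ M) (hN : D.IsGrFractionalIdeal Λ N) (h : M ≤ N) :
    latticeInv N ≤ latticeInv M :=
  (hΛ.le_latticeInv_iff_mul_le hM).2 <|
    (mul_le_mul_right h _).trans (hΛ.latticeInv_mul_le hN)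

theorem IsGrMaximalOrder.le_latticeInv_latticeInv (hΛ : D.IsGrMaximalOrder Λ)
    (hM : D.IsGrFractionalIdeal Λ M) : M ≤ latticeInv (latticeInv M) :=
  (hΛ.le_latticeInv_iff_mul_le (hΛ.isGrFractionalIdeal_latticeInv hM)).2
    (hΛ.mul_latticeInv_le hM)

theorem IsGrMaximalOrder.latticeInv_latticeInv_latticeInv (hΛ : D.IsGrMaximalOrder Λ)
    (hM : D.IsGrFractionalIdeal Λ M) :
    latticeInv (latticeInv (latticeInv M)) = latticeInv M := by
  have hM' := hΛ.isGrFractionalIdeal_latticeInv hM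
  exact (hΛ.latticeInv_anti hM (hΛ.isGrFractionalIdeal_latticeInv hM')
    (hΛ.le_latticeInv_latticeInv hM)).antisymm (hΛ.le_latticeInv_latticeInv hM')

theorem IsGrMaximalOrder.latticeInv_latticeInv_mul_le_iff (hΛ : D.IsGrMaximalOrder Λ)
    (hM : D.IsGrFractionalIdeal Λ M) : latticeInv (latticeInv M) * N ≤ Λ ↔ M * N ≤ Λ := by
  have hM' := hΛ.isGrFractionalIdeal_latticeInv hM
  rw [← hΛ.le_latticeInv_iff_mul_le' hM,
    ← hΛ.le_latticeInv_iff_mul_le' (hΛ.isGrFractionalIdeal_latticeInv hM'),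
    hΛ.latticeInv_latticeInv_latticeInv hM]

theorem IsGrMaximalOrder.latticeInv_latticeInv_mul_latticeInv_latticeInv_le
    (hΛ : D.IsGrMaximalOrder Λ) {I : AddSubgroup A} (hM : D.IsGrFractionalIdeal Λ M)
    (hN : D.IsGrFractionalIdeal Λ N) (hI : D.IsGrFractionalIdeal Λ I) (h : M * N ≤ I) :
    latticeInv (latticeInv M) * latticeInv (latticeInv N) ≤ latticeInv (latticeInv I) := by
  have hI' := hΛ.isGrFractionalIdeal_latticeInv hI
  have hMN : M * (N * latticeInv I) ≤ Λ := by
    rw [← mul_assoc]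
    exact (mul_le_mul_left h _).trans (hΛ.mul_latticeInv_le hI)
  have hNM : N * (latticeInv I * latticeInv (latticeInv M)) ≤ Λ := by
    rwa [← mul_assoc, ← hΛ.mul_le_comm (hΛ.isGrFractionalIdeal_latticeInv
      (hΛ.isGrFractionalIdeal_latticeInv hM)), hΛ.latticeInv_latticeInv_mul_le_iff hM]
  rwa [hΛ.le_latticeInv_iff_mul_le' hI', ← mul_assoc, ← hΛ.mul_le_comm
    (hΛ.isGrFractionalIdeal_latticeInv (hΛ.isGrFractionalIdeal_latticeInv hN)),
    hΛ.latticeInv_latticeInv_mul_le_iff hN]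

end MaximalOrder

section ChainConditions

variable {D : CrystallineGradedRing R K G A} {Λ : AddSubgroup A}

theorem IsGrOrder.exists_maximal [IsNoetherianRing R] (hΛ : D.IsGrOrder Λ)
    {p : AddSubgroup A → Prop} (hp : ∀ N, p N → Λ * N ≤ N ∧ N ≤ Λ) (hne : ∃ N, p N) :
    ∃ N, Maximal p N := by
  let := D.leftModule
  let toSubmodule (N : AddSubgroup A) (hN : Λ * N ≤ N) : Submodule R A :=
    { N with smul_mem' := fun r n hn => addSubgroup_mul_le.1 hN _ (hΛ.φ_mem r) n hn }
  obtain ⟨N₀, hN₀⟩ := hne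
  obtain ⟨N, hN, hmax⟩ := exists_maximal_submodule_of_fg (N := toSubmodule Λ hΛ.mul_self_le)
    (exists_finset_closure_smul_eq_iff_fg.1 hΛ.left_fg) (p := fun N => p N.toAddSubgroup)
    (fun N hN => (hp _ hN).2) ⟨toSubmodule N₀ (hp N₀ hN₀).1, hN₀⟩
  exact ⟨N.toAddSubgroup, hN, fun N' hN' => hmax (y := toSubmodule N' (hp N' hN').1) hN'⟩

theorem IsGrOrder.exists_minimal [IsNoetherianRing R] [Ring.KrullDimLE 1 R]
    (hΛ : D.IsGrOrder Λ) {P : AddSubgroup A} (hP : D.IsGrFractionalIdeal Λ P)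
    {p : AddSubgroup A → Prop} (hp : ∀ N, p N → Λ * N ≤ N ∧ P ≤ N ∧ N ≤ Λ) (hne : ∃ N, p N) :
    ∃ N, Minimal p N := by
  let := D.leftModule
  let toSubmodule (N : AddSubgroup A) (hN : Λ * N ≤ N) : Submodule R A :=
    { N with smul_mem' := fun r n hn => addSubgroup_mul_le.1 hN _ (hΛ.φ_mem r) n hn }
  obtain ⟨N₀, hN₀⟩ := hne
  obtain ⟨_, ⟨r, ⟨hr, -⟩, rfl⟩, hrP⟩ := hP.exists_scalar_mem
  obtain ⟨N, hN, hmin⟩ := exists_minimal_submodule_of_smul_mem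
    (P := toSubmodule P hP.mul_le_left) (N := toSubmodule Λ hΛ.mul_self_le)
    (exists_finset_closure_smul_eq_iff_fg.1 hΛ.left_fg) hr
    (fun x hx => addSubgroup_mul_le.1 hP.mul_le_right _ hrP x hx)
    (p := fun N => p N.toAddSubgroup)
    (fun N hN => (hp _ hN).2) ⟨toSubmodule N₀ (hp N₀ hN₀).1, hN₀⟩
  exact ⟨N.toAddSubgroup, hN, fun N' hN' => hmin (y := toSubmodule N' (hp N' hN').1) hN'⟩

end ChainConditions

section PrimesAreMaximal

/-- Graded left ideals of `Λ`, not necessarily full lattices. -/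
structure IsGrLeftIdeal (D : CrystallineGradedRing R K G A) (Λ N : AddSubgroup A) : Prop where
  graded : D.IsGraded N
  mul_le_left : Λ * N ≤ N
  le : N ≤ Λ

variable {D : CrystallineGradedRing R K G A} {Λ P S L N : AddSubgroup A}

theorem IsGrOrder.isGrLeftIdeal (hΛ : D.IsGrOrder Λ) : D.IsGrLeftIdeal Λ Λ :=
  ⟨hΛ.graded, hΛ.mul_self_le, le_rfl⟩

theorem IsTwoSidedGrIdeal.mul_le_left (hS : D.IsTwoSidedGrIdeal Λ S) : Λ * S ≤ S :=
  addSubgroup_mul_le.2 hS.mul_mem_left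

theorem IsTwoSidedGrIdeal.mul_le_right (hS : D.IsTwoSidedGrIdeal Λ S) : S * Λ ≤ S :=
  addSubgroup_mul_le.2 fun s hs x hx => hS.mul_mem_right x hx s hs

theorem IsTwoSidedGrIdeal.isGrLeftIdeal (hS : D.IsTwoSidedGrIdeal Λ S) : D.IsGrLeftIdeal Λ S :=
  ⟨hS.graded, hS.mul_le_left, hS.le⟩

theorem IsGrLeftIdeal.sup (hN : D.IsGrLeftIdeal Λ N) (hL : D.IsGrLeftIdeal Λ L) :
    D.IsGrLeftIdeal Λ (N ⊔ L) where
  graded := hN.graded.sup hL.graded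
  mul_le_left := addSubgroup_mul_sup_le (hN.mul_le_left.trans le_sup_left)
    (hL.mul_le_left.trans le_sup_right)
  le := sup_le hN.le hL.le

theorem IsGrLeftIdeal.mul (hN : D.IsGrLeftIdeal Λ N) (hL : D.IsGrLeftIdeal Λ L) :
    D.IsGrLeftIdeal Λ (N * L) where
  graded := hN.graded.mul hL.graded
  mul_le_left := by
    rw [← mul_assoc]
    exact mul_le_mul_left hN.mul_le_left L
  le := (mul_le_mul_left hN.le L).trans (hL.mul_le_left.trans hL.le)

theorem IsGrLeftIdeal.map_mulRight_proj (hN : D.IsGrLeftIdeal Λ N) (hL : D.IsGrLeftIdeal Λ L)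
    {x : A} (hx : x ∈ L) (g : G) :
    D.IsGrLeftIdeal Λ (N.map (AddMonoidHom.mulRight (D.proj g x))) where
  graded := hN.graded.map_mulRight_proj g x
  mul_le_left := by
    rw [addSubgroup_mul_le]
    rintro a ha _ ⟨n, hn, rfl⟩
    exact ⟨a * n, addSubgroup_mul_le.1 hN.mul_le_left a ha n hn, mul_assoc a n _⟩
  le := by
    rintro _ ⟨n, hn, rfl⟩
    exact hL.le (addSubgroup_mul_le.1 hL.mul_le_left n (hN.le hn) _ (hL.graded.proj_mem g hx))

theorem IsGrLeftIdeal.inf_comap_mulRight_proj (hN : D.IsGrLeftIdeal Λ N)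
    (hL : D.IsGrLeftIdeal Λ L) (g : G) (x : A) :
    D.IsGrLeftIdeal Λ (N ⊓ L.comap (AddMonoidHom.mulRight (D.proj g x))) where
  graded := hN.graded.inf (hL.graded.comap_mulRight_proj g x)
  mul_le_left := by
    rw [addSubgroup_mul_le]
    rintro a ha n ⟨hn, hnx⟩
    refine ⟨addSubgroup_mul_le.1 hN.mul_le_left a ha n hn, ?_⟩
    change a * n * _ ∈ L
    rw [mul_assoc]
    exact addSubgroup_mul_le.1 hL.mul_le_left a ha _ hnx
  le := inf_le_left.trans hN.le

variable [IsNoetherianRing R] [IsFractionRing R K]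

theorem IsGrLeftIdeal.mul_order (hN : D.IsGrLeftIdeal Λ N) (hP : D.IsTwoSidedGrIdeal Λ P)
    (hΛ : D.IsGrOrder Λ) (h : P ≤ N) : D.IsTwoSidedGrIdeal Λ (N * Λ) := by
  obtain ⟨z, hz, hzP⟩ := hP.isGrFractionalIdeal.exists_scalar_mem
  have hNΛ := hN.mul hΛ.isGrLeftIdeal
  have mul_le_right : N * Λ * Λ ≤ N * Λ := by rw [mul_assoc, hΛ.mul_self]
  exact (IsGrFractionalIdeal.of_le hNΛ.graded hNΛ.mul_le_left mul_le_right hz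
    (hΛ.le_mul_right (h hzP)) hNΛ.le).isTwoSidedGrIdeal hΛ hNΛ.le

theorem IsGrPrime.le_or_le_of_isGrLeftIdeal (hP : D.IsGrPrime Λ P) (hΛ : D.IsGrOrder Λ)
    (hN : D.IsGrLeftIdeal Λ N) (hL : D.IsGrLeftIdeal Λ L) (hPN : P ≤ N) (hPL : P ≤ L)
    (h : N * L ≤ P) : N ≤ P ∨ L ≤ P := by
  have hP' := hP.toIsTwoSidedGrIdeal
  have mul_le : N * Λ * (L * Λ) ≤ P := by
    rw [mul_assoc, ← mul_assoc Λ, ← mul_assoc]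
    calc N * (Λ * L) * Λ ≤ N * L * Λ := by gcongr; exact hL.mul_le_left
      _ ≤ P * Λ := by gcongr
      _ ≤ P := hP'.mul_le_right
  exact (hP.le_or_le _ _ (hN.mul_order hP' hΛ hPN) (hL.mul_order hP' hΛ hPL) mul_le).imp
    hΛ.le_mul_right.trans hΛ.le_mul_right.trans

theorem IsGrPrime.mul_sup_eq_of_minimal (hP : D.IsGrPrime Λ P) (hΛ : D.IsGrOrder Λ)
    (hS : D.IsTwoSidedGrIdeal Λ S) (hPS : P < S)
    (hL : Minimal (fun L => D.IsGrLeftIdeal Λ L ∧ P < L) L) : S * L ⊔ P = L := by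
  obtain ⟨hL', hPL⟩ := hL.prop
  have hSL : S * L ≤ L := (mul_le_mul_left hS.le L).trans hL'.mul_le_left
  refine (sup_le hSL hPL.le).antisymm <| hL.le_of_le
    ⟨(hS.isGrLeftIdeal.mul hL').sup hP.isGrLeftIdeal, lt_of_le_not_ge le_sup_right fun h => ?_⟩
    (sup_le hSL hPL.le)
  exact (hP.le_or_le_of_isGrLeftIdeal hΛ hS.isGrLeftIdeal hL' hPS.le hPL.le
    (le_sup_left.trans h)).elim hPS.not_ge hPL.not_ge

theorem IsGrPrime.mul_le_of_minimal (hP : D.IsGrPrime Λ P) (hΛ : D.IsGrOrder Λ)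
    (hS : D.IsTwoSidedGrIdeal Λ S) (hPS : P < S)
    (hL : Minimal (fun L => D.IsGrLeftIdeal Λ L ∧ P < L) L)
    (hN : Minimal (fun N => D.IsGrLeftIdeal Λ N ∧ P ≤ N ∧ Λ ≤ S ⊔ N) N) : N * L ≤ P := by
  obtain ⟨hL', hPL⟩ := hL.prop
  obtain ⟨hN', hPN, hSN⟩ := hN.prop
  suffices map_le : ∀ l ∈ L, ∀ g, N.map (AddMonoidHom.mulRight (D.proj g l)) ≤ P by
    refine addSubgroup_mul_le.2 fun n hn l hl => ?_
    rw [← D.sum_proj l, Finset.mul_sum]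
    exact sum_mem fun g _ => map_le l hl g ⟨n, hn, rfl⟩
  intro l hl g
  by_contra hx
  have hxL : N.map (AddMonoidHom.mulRight (D.proj g l)) ≤ L := by
    rintro _ ⟨n, hn, rfl⟩
    exact addSubgroup_mul_le.1 hL'.mul_le_left n (hN'.le hn) _ (hL'.graded.proj_mem g hl)
  have map_sup_eq : N.map (AddMonoidHom.mulRight (D.proj g l)) ⊔ P = L :=
    (sup_le hxL hPL.le).antisymm <| hL.le_of_le
      ⟨(hN'.map_mulRight_proj hL' hl g).sup hP.isGrLeftIdeal,
        lt_of_le_not_ge le_sup_right fun h => hx (le_sup_left.trans h)⟩ (sup_le hxL hPL.le)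
  have hSN' : S * N ≤ S ⊓ N := le_inf ((mul_le_mul_right hN'.le S).trans hS.mul_le_right)
    ((mul_le_mul_left hS.le N).trans hN'.mul_le_left)
  have hN_le := le_sup_inf_comap_mulRight hSN' ((mul_le_mul_left hS.le P).trans hP.mul_le_left)
    map_sup_eq (hP.mul_sup_eq_of_minimal hΛ hS hPS hL)
  have hP_le : P ≤ N ⊓ P.comap (AddMonoidHom.mulRight (D.proj g l)) := le_inf hPN fun p hp =>
    addSubgroup_mul_le.1 hP.mul_le_right p hp _ (hL'.le (hL'.graded.proj_mem g hl))
  have hN_le' := hN.le_of_le ⟨hN'.inf_comap_mulRight_proj hP.isGrLeftIdeal g l, hP_le,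
    hSN.trans (sup_le le_sup_left hN_le)⟩ inf_le_left
  exact hx (AddSubgroup.map_le_iff_le_comap.2 (hN_le'.trans inf_le_right))

variable [Ring.KrullDimLE 1 R]

theorem IsGrPrime.exists_minimal_lt (hP : D.IsGrPrime Λ P) (hΛ : D.IsGrOrder Λ) :
    ∃ L, Minimal (fun L => D.IsGrLeftIdeal Λ L ∧ P < L) L :=
  hΛ.exists_minimal hP.isGrFractionalIdeal (fun _ hL => ⟨hL.1.mul_le_left, hL.2.le, hL.1.le⟩)
    ⟨Λ, hΛ.isGrLeftIdeal, hP.le.lt_of_ne hP.ne_self⟩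

theorem IsGrPrime.eq_of_lt (hP : D.IsGrPrime Λ P) (hΛ : D.IsGrOrder Λ)
    (hS : D.IsTwoSidedGrIdeal Λ S) (hPS : P < S) : S = Λ := by
  obtain ⟨L, hL⟩ := hP.exists_minimal_lt hΛ
  obtain ⟨N, hN⟩ := hΛ.exists_minimal hP.isGrFractionalIdeal
    (p := fun N => D.IsGrLeftIdeal Λ N ∧ P ≤ N ∧ Λ ≤ S ⊔ N)
    (fun N hN => ⟨hN.1.mul_le_left, hN.2.1, hN.1.le⟩)
    ⟨Λ, hΛ.isGrLeftIdeal, hP.le, le_sup_right⟩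
  obtain ⟨hN', hPN, hSN⟩ := hN.prop
  have hNP : N ≤ P := (hP.le_or_le_of_isGrLeftIdeal hΛ hN' hL.prop.1 hPN hL.prop.2.le
    (hP.mul_le_of_minimal hΛ hS hPS hL hN)).resolve_right hL.prop.2.not_ge
  exact hS.le.antisymm (hSN.trans (sup_le le_rfl (hNP.trans hPS.le)))

end PrimesAreMaximal

variable {D : CrystallineGradedRing R K G A} {Λ M N P : AddSubgroup A}
  [IsNoetherianRing R] [IsFractionRing R K]

section ExistenceOfPrimes

theorem IsTwoSidedGrIdeal.sup (hM : D.IsTwoSidedGrIdeal Λ M) (hN : D.IsTwoSidedGrIdeal Λ N)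
    (hΛ : D.IsGrOrder Λ) : D.IsTwoSidedGrIdeal Λ (M ⊔ N) := by
  obtain ⟨z, hz, hzM⟩ := hM.isGrFractionalIdeal.exists_scalar_mem
  have hMN := hM.isGrLeftIdeal.sup hN.isGrLeftIdeal
  have mul_le_right : (M ⊔ N) * Λ ≤ M ⊔ N := addSubgroup_sup_mul_le
    (hM.mul_le_right.trans le_sup_left) (hN.mul_le_right.trans le_sup_right)
  exact (IsGrFractionalIdeal.of_le hMN.graded hMN.mul_le_left mul_le_right hz
    (AddSubgroup.mem_sup_left hzM) hMN.le).isTwoSidedGrIdeal hΛ hMN.le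

theorem IsTwoSidedGrIdeal.isGrPrime_of_forall_ge (hP : D.IsTwoSidedGrIdeal Λ P)
    (hΛ : D.IsGrOrder Λ) (hne : P ≠ Λ)
    (h : ∀ S T, D.IsTwoSidedGrIdeal Λ S → D.IsTwoSidedGrIdeal Λ T → P ≤ S → P ≤ T →
      S * T ≤ P → S ≤ P ∨ T ≤ P) : D.IsGrPrime Λ P where
  toIsTwoSidedGrIdeal := hP
  ne_self := hne
  le_or_le S T hS hT hST := by
    have hSP : S * P ≤ P := (mul_le_mul_left hS.le P).trans hP.mul_le_left
    have hPT : P * T ≤ P := (mul_le_mul_right hT.le P).trans hP.mul_le_right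
    have hPP : P * P ≤ P := (mul_le_mul_right hP.le P).trans hP.mul_le_right
    exact (h (S ⊔ P) (T ⊔ P) (hS.sup hP hΛ) (hT.sup hP hΛ) le_sup_right le_sup_right
      (addSubgroup_sup_mul_le (addSubgroup_mul_sup_le hST hSP)
        (addSubgroup_mul_sup_le hPT hPP))).imp le_sup_left.trans le_sup_left.trans

theorem IsTwoSidedGrIdeal.exists_isGrPrime_ge (hM : D.IsTwoSidedGrIdeal Λ M)
    (hΛ : D.IsGrOrder Λ) (hne : M ≠ Λ) : ∃ P, D.IsGrPrime Λ P ∧ M ≤ P := by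
  obtain ⟨P, hP⟩ := hΛ.exists_maximal
    (p := fun P => D.IsTwoSidedGrIdeal Λ P ∧ P ≠ Λ ∧ M ≤ P)
    (fun P hP => ⟨hP.1.mul_le_left, hP.1.le⟩) ⟨M, hM, hne, le_rfl⟩
  obtain ⟨hP', hPΛ, hMP⟩ := hP.prop
  refine ⟨P, hP'.isGrPrime_of_forall_ge hΛ hPΛ fun S T hS _ hPS _ hST => ?_, hMP⟩
  by_cases hSΛ : S = Λ
  · exact .inr (hΛ.le_mul_left.trans (hSΛ ▸ hST))
  · exact .inl (hP.le_of_ge ⟨hS, hSΛ, hMP.trans hPS⟩ hPS)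

end ExistenceOfPrimes

section Reflexivity

theorem IsGrOrder.isTwoSidedGrIdeal_map_mulLeft (hΛ : D.IsGrOrder Λ) {z : A}
    (hz : z ∈ D.invariantScalars) :
    D.IsTwoSidedGrIdeal Λ (Λ.map (AddMonoidHom.mulLeft z)) := by
  have hzΛ : z ∈ Λ := by
    obtain ⟨r, -, rfl⟩ := hz
    exact hΛ.φ_mem r
  have hle : Λ.map (AddMonoidHom.mulLeft z) ≤ Λ := by
    rintro _ ⟨a, ha, rfl⟩
    exact hΛ.mul_mem z hzΛ a ha
  refine IsGrFractionalIdeal.isTwoSidedGrIdeal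
    (.of_le ?_ (addSubgroup_mul_le.2 ?_) (addSubgroup_mul_le.2 ?_) hz
      ⟨1, hΛ.one_mem, mul_one z⟩ hle) hΛ hle
  · obtain ⟨r, -, rfl⟩ := hz
    exact hΛ.graded.map_mulLeft_φ r
  · rintro b hb _ ⟨a, ha, rfl⟩
    refine ⟨b * a, hΛ.mul_mem b hb a ha, ?_⟩
    change z * (b * a) = b * (z * a)
    rw [← mul_assoc, ← mul_assoc, Submonoid.mem_center_iff.1 (D.invariantScalars_le_center hz)]
  · rintro _ ⟨a, ha, rfl⟩ b hb
    exact ⟨a * b, hΛ.mul_mem a ha b hb, (mul_assoc z a b).symm⟩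

theorem IsGrMaximalOrder.latticeInv_latticeInv_map_mulLeft_le (hΛ : D.IsGrMaximalOrder Λ)
    {z : A} (hz : z ∈ D.invariantScalars) :
    latticeInv (latticeInv (Λ.map (AddMonoidHom.mulLeft z))) ≤
      Λ.map (AddMonoidHom.mulLeft z) := by
  have hI := (hΛ.isGrOrder.isTwoSidedGrIdeal_map_mulLeft hz).isGrFractionalIdeal
  obtain ⟨y, -, hyz⟩ := isUnit_iff_exists.1 (isUnit_of_mem_invariantScalars hz)
  have hy : y ∈ latticeInv (Λ.map (AddMonoidHom.mulLeft z)) := by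
    rw [hΛ.latticeInv_eq_leftResidual_order hI]
    rintro _ ⟨a, ha, rfl⟩
    change y * (z * a) ∈ Λ
    rwa [← mul_assoc, hyz, one_mul]
  intro t ht
  have hty : t * y ∈ Λ := addSubgroup_mul_le.1
    (hΛ.latticeInv_mul_le (hΛ.isGrFractionalIdeal_latticeInv hI)) t ht y hy
  refine ⟨t * y, hty, ?_⟩
  change z * (t * y) = t
  rw [← Submonoid.mem_center_iff.1 (D.invariantScalars_le_center hz), mul_assoc, hyz, mul_one]

theorem IsGrMaximalOrder.isTwoSidedGrIdeal_latticeInv_latticeInv (hΛ : D.IsGrMaximalOrder Λ)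
    (hM : D.IsTwoSidedGrIdeal Λ M) :
    D.IsTwoSidedGrIdeal Λ (latticeInv (latticeInv M)) := by
  have hM' := hΛ.isGrFractionalIdeal_latticeInv hM.isGrFractionalIdeal
  have order_le : Λ ≤ latticeInv M :=
    (hΛ.le_latticeInv_iff_mul_le hM.isGrFractionalIdeal).2 (hM.mul_le_left.trans hM.le)
  exact (hΛ.isGrFractionalIdeal_latticeInv hM').isTwoSidedGrIdeal hΛ.isGrOrder <|
    hΛ.isGrOrder.le_mul_right.trans <|
      (mul_le_mul_right order_le _).trans (hΛ.latticeInv_mul_le hM')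

theorem IsGrPrime.exists_reflexive_isGrPrime_le (hP : D.IsGrPrime Λ P)
    (hΛ : D.IsGrMaximalOrder Λ) :
    ∃ I, D.IsGrPrime Λ I ∧ latticeInv (latticeInv I) = I ∧ I ≤ P := by
  obtain ⟨z, hz, hzP⟩ := hP.isGrFractionalIdeal.exists_scalar_mem
  have map_le : Λ.map (AddMonoidHom.mulLeft z) ≤ P := by
    rintro _ ⟨a, ha, rfl⟩
    exact hP.mul_mem_right a ha z hzP
  obtain ⟨I, hI⟩ := hΛ.isGrOrder.exists_maximal
    (p := fun I => D.IsTwoSidedGrIdeal Λ I ∧ latticeInv (latticeInv I) ≤ P)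
    (fun I hI => ⟨hI.1.mul_le_left, hI.1.le⟩)
    ⟨_, hΛ.isGrOrder.isTwoSidedGrIdeal_map_mulLeft hz,
      (hΛ.latticeInv_latticeInv_map_mulLeft_le hz).trans map_le⟩
  obtain ⟨hI', hIP⟩ := hI.prop
  have hIF := hI'.isGrFractionalIdeal
  have I_reflexive : latticeInv (latticeInv I) = I := by
    refine (hI.eq_of_le ⟨hΛ.isTwoSidedGrIdeal_latticeInv_latticeInv hI', ?_⟩
      (hΛ.le_latticeInv_latticeInv hIF)).symm
    rwa [hΛ.latticeInv_latticeInv_latticeInv (hΛ.isGrFractionalIdeal_latticeInv hIF)]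
  rw [I_reflexive] at hIP
  refine ⟨I, hI'.isGrPrime_of_forall_ge hΛ.isGrOrder
    (fun h => hP.ne_self (hP.le.antisymm (h ▸ hIP))) fun S T hS hT hIS hIT hST => ?_,
    I_reflexive, hIP⟩
  have hST' := hΛ.latticeInv_latticeInv_mul_latticeInv_latticeInv_le hS.isGrFractionalIdeal
    hT.isGrFractionalIdeal hIF hST
  rw [I_reflexive] at hST'
  exact (hP.le_or_le _ _ (hΛ.isTwoSidedGrIdeal_latticeInv_latticeInv hS)
    (hΛ.isTwoSidedGrIdeal_latticeInv_latticeInv hT) (hST'.trans hIP)).imp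
    (fun h => hI.le_of_ge ⟨hS, h⟩ hIS) (fun h => hI.le_of_ge ⟨hT, h⟩ hIT)

variable [Ring.KrullDimLE 1 R]

theorem IsGrPrime.eq_of_le (hP : D.IsGrPrime Λ P) (hN : D.IsGrPrime Λ N) (hΛ : D.IsGrOrder Λ)
    (h : P ≤ N) : P = N :=
  h.eq_of_not_lt fun hlt => hN.ne_self (hP.eq_of_lt hΛ hN.toIsTwoSidedGrIdeal hlt)

theorem IsGrPrime.latticeInv_latticeInv (hP : D.IsGrPrime Λ P) (hΛ : D.IsGrMaximalOrder Λ) :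
    latticeInv (latticeInv P) = P := by
  obtain ⟨I, I_prime, I_reflexive, hIP⟩ := hP.exists_reflexive_isGrPrime_le hΛ
  rw [← I_prime.eq_of_le hP hΛ.isGrOrder hIP, I_reflexive]

theorem IsGrMaximalOrder.eq_of_latticeInv_le (hΛ : D.IsGrMaximalOrder Λ)
    (hM : D.IsTwoSidedGrIdeal Λ M) (h : latticeInv M ≤ Λ) : M = Λ := by
  by_contra hne
  obtain ⟨P, hP, hMP⟩ := hM.exists_isGrPrime_ge hΛ.isGrOrder hne
  have hPF := hP.isGrFractionalIdeal
  have hPΛ : latticeInv P ≤ Λ := (hΛ.latticeInv_anti hM.isGrFractionalIdeal hPF hMP).trans h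
  have order_le : Λ ≤ latticeInv (latticeInv P) :=
    (hΛ.le_latticeInv_iff_mul_le (hΛ.isGrFractionalIdeal_latticeInv hPF)).2
      ((mul_le_mul_right hPΛ Λ).trans hΛ.isGrOrder.mul_self_le)
  exact hP.ne_self (hP.le.antisymm (order_le.trans (hP.latticeInv_latticeInv hΛ).le))

end Reflexivity

section GroupOfFractionalIdeals

variable [Ring.KrullDimLE 1 R]

theorem IsGrFractionalIdeal.mul_latticeInv (hM : D.IsGrFractionalIdeal Λ M)
    (hΛ : D.IsGrMaximalOrder Λ) : M * latticeInv M = Λ := by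
  have hM' := hΛ.isGrFractionalIdeal_latticeInv hM
  have hJ := (hM.mul hM' hΛ.isGrOrder).isTwoSidedGrIdeal hΛ.isGrOrder (hΛ.mul_latticeInv_le hM)
  refine hΛ.eq_of_latticeInv_le hJ ?_
  rw [← hΛ.rightResidual_self hM', le_rightResidual_iff, hΛ.le_latticeInv_iff_mul_le' hM,
    ← mul_assoc]
  exact hΛ.mul_latticeInv_le hJ.isGrFractionalIdeal

theorem IsGrFractionalIdeal.latticeInv_mul (hM : D.IsGrFractionalIdeal Λ M)
    (hΛ : D.IsGrMaximalOrder Λ) : latticeInv M * M = Λ := by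
  have hM' := hΛ.isGrFractionalIdeal_latticeInv hM
  have hJ := (hM'.mul hM hΛ.isGrOrder).isTwoSidedGrIdeal hΛ.isGrOrder (hΛ.latticeInv_mul_le hM)
  refine hΛ.eq_of_latticeInv_le hJ ?_
  rw [← hΛ.leftResidual_self hM', le_leftResidual_iff, hΛ.le_latticeInv_iff_mul_le hM, mul_assoc]
  exact hΛ.latticeInv_mul_le hJ.isGrFractionalIdeal

theorem IsGrFractionalIdeal.latticeInv_latticeInv (hM : D.IsGrFractionalIdeal Λ M)
    (hΛ : D.IsGrMaximalOrder Λ) : latticeInv (latticeInv M) = M := by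
  have hM' := hΛ.isGrFractionalIdeal_latticeInv hM
  rw [← (hΛ.isGrFractionalIdeal_latticeInv hM').order_mul hΛ.isGrOrder, ← hM.mul_latticeInv hΛ,
    mul_assoc, hM'.mul_latticeInv hΛ, hM.mul_order hΛ.isGrOrder]

theorem IsGrFractionalIdeal.mul_left_cancel {S T : AddSubgroup A}
    (hM : D.IsGrFractionalIdeal Λ M) (hS : D.IsGrFractionalIdeal Λ S)
    (hT : D.IsGrFractionalIdeal Λ T) (hΛ : D.IsGrMaximalOrder Λ) (h : M * S = M * T) :
    S = T := by
  rw [← hS.order_mul hΛ.isGrOrder, ← hT.order_mul hΛ.isGrOrder, ← hM.latticeInv_mul hΛ,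
    mul_assoc, mul_assoc, h]

end GroupOfFractionalIdeals

section Factorization

theorem isTwoSidedGrIdeal_idealProd (hΛ : D.IsGrOrder Λ) {l : List (AddSubgroup A)}
    (hl : ∀ P ∈ l, D.IsGrPrime Λ P) : D.IsTwoSidedGrIdeal Λ (idealProd Λ l) := by
  induction l with
  | nil => exact hΛ.isGrFractionalIdeal.isTwoSidedGrIdeal hΛ le_rfl
  | cons P l ih =>
    obtain ⟨hP, hl⟩ := List.forall_mem_cons.1 hl
    exact (hP.isGrFractionalIdeal.mul (ih hl).isGrFractionalIdeal hΛ).isTwoSidedGrIdeal hΛ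
      ((mul_le_mul_right (ih hl).le P).trans (hP.mul_le_right.trans hP.le))

variable [Ring.KrullDimLE 1 R]

theorem IsTwoSidedGrIdeal.exists_eq_mul_of_le (hM : D.IsTwoSidedGrIdeal Λ M)
    (hN : D.IsTwoSidedGrIdeal Λ N) (hΛ : D.IsGrMaximalOrder Λ) (h : N ≤ M) :
    ∃ S, D.IsTwoSidedGrIdeal Λ S ∧ M * S = N := by
  have hMF := hM.isGrFractionalIdeal
  have hNF := hN.isGrFractionalIdeal
  refine ⟨latticeInv M * N, ((hΛ.isGrFractionalIdeal_latticeInv hMF).mul hNF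
    hΛ.isGrOrder).isTwoSidedGrIdeal hΛ.isGrOrder ?_, ?_⟩
  · exact (mul_le_mul_right h _).trans (hΛ.latticeInv_mul_le hMF)
  · rw [← mul_assoc, hMF.mul_latticeInv hΛ, hNF.order_mul hΛ.isGrOrder]

theorem IsGrPrime.mul_le_mul_comm {Q : AddSubgroup A} (hP : D.IsGrPrime Λ P)
    (hQ : D.IsGrPrime Λ Q) (hΛ : D.IsGrMaximalOrder Λ) : P * Q ≤ Q * P := by
  have hPQ : P * Q ≤ P := (mul_le_mul_right hQ.le P).trans hP.mul_le_right
  have hPQ' : P * Q ≤ Q := (mul_le_mul_left hP.le Q).trans hQ.mul_le_left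
  have hPQF := hP.isGrFractionalIdeal.mul hQ.isGrFractionalIdeal hΛ.isGrOrder
  obtain ⟨S, hS, hQS⟩ := hQ.toIsTwoSidedGrIdeal.exists_eq_mul_of_le
    (hPQF.isTwoSidedGrIdeal hΛ.isGrOrder (hPQ.trans hP.le)) hΛ hPQ'
  rcases hP.le_or_le Q S hQ.toIsTwoSidedGrIdeal hS (hQS.trans_le hPQ) with hQP | hSP
  · rw [hQ.eq_of_le hP hΛ.isGrOrder hQP]
  · rw [← hQS]
    exact mul_le_mul_right hSP Q

theorem IsGrPrime.mul_comm {Q : AddSubgroup A} (hP : D.IsGrPrime Λ P) (hQ : D.IsGrPrime Λ Q)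
    (hΛ : D.IsGrMaximalOrder Λ) : P * Q = Q * P :=
  (hP.mul_le_mul_comm hQ hΛ).antisymm (hQ.mul_le_mul_comm hP hΛ)

theorem IsTwoSidedGrIdeal.exists_idealProd_eq (hM : D.IsTwoSidedGrIdeal Λ M)
    (hΛ : D.IsGrMaximalOrder Λ) :
    ∃ l : List (AddSubgroup A), (∀ P ∈ l, D.IsGrPrime Λ P) ∧ idealProd Λ l = M := by
  by_contra hM_factor
  obtain ⟨N, hN⟩ := hΛ.isGrOrder.exists_maximal
    (p := fun N => D.IsTwoSidedGrIdeal Λ N ∧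
      ¬∃ l : List (AddSubgroup A), (∀ P ∈ l, D.IsGrPrime Λ P) ∧ idealProd Λ l = N)
    (fun N hN => ⟨hN.1.mul_le_left, hN.1.le⟩) ⟨M, hM, hM_factor⟩
  obtain ⟨hN', hN_factor⟩ := hN.prop
  have hNΛ : N ≠ Λ := fun h => hN_factor ⟨[], List.forall_mem_nil _, h.symm⟩
  obtain ⟨P, hP, hNP⟩ := hN'.exists_isGrPrime_ge hΛ.isGrOrder hNΛ
  obtain ⟨S, hS, rfl⟩ := hP.toIsTwoSidedGrIdeal.exists_eq_mul_of_le hN' hΛ hNP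
  have hPS : P * S ≤ S := (mul_le_mul_left hP.le S).trans hS.mul_le_left
  have hPS_ne : P * S ≠ S := fun h => hP.ne_self <| by
    rw [← hP.isGrFractionalIdeal.mul_order hΛ.isGrOrder,
      ← hS.isGrFractionalIdeal.mul_latticeInv hΛ, ← mul_assoc, h]
  refine hN.not_prop_of_gt (hPS.lt_of_ne hPS_ne) ⟨hS, fun ⟨l, hl, hlS⟩ => ?_⟩
  exact hN_factor ⟨P :: l, List.forall_mem_cons.2 ⟨hP, hl⟩, congrArg (P * ·) hlS⟩

theorem IsGrPrime.mem_of_idealProd_le (hP : D.IsGrPrime Λ P) (hΛ : D.IsGrOrder Λ)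
    {l : List (AddSubgroup A)} (hl : ∀ Q ∈ l, D.IsGrPrime Λ Q) (h : idealProd Λ l ≤ P) :
    P ∈ l := by
  induction l with
  | nil => exact absurd (hP.le.antisymm h) hP.ne_self
  | cons Q l ih =>
    obtain ⟨hQ, hl⟩ := List.forall_mem_cons.1 hl
    rcases hP.le_or_le _ _ hQ.toIsTwoSidedGrIdeal (isTwoSidedGrIdeal_idealProd hΛ hl) h
      with hQP | hlP
    · exact hQ.eq_of_le hP hΛ hQP ▸ List.mem_cons_self
    · exact List.mem_cons_of_mem _ (ih hl hlP)

theorem idealProd_eq_of_perm (hΛ : D.IsGrMaximalOrder Λ) {l l' : List (AddSubgroup A)}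
    (hl : ∀ P ∈ l, D.IsGrPrime Λ P) (h : l.Perm l') : idealProd Λ l = idealProd Λ l' :=
  h.foldr_eq' (fun P hP Q hQ N => by
    rw [← mul_assoc, (hl Q hQ).mul_comm (hl P hP) hΛ, mul_assoc]) Λ

theorem perm_of_idealProd_eq (hΛ : D.IsGrMaximalOrder Λ) {l l' : List (AddSubgroup A)}
    (hl : ∀ P ∈ l, D.IsGrPrime Λ P) (hl' : ∀ P ∈ l', D.IsGrPrime Λ P)
    (h : idealProd Λ l = idealProd Λ l') : l.Perm l' := by
  classical
  induction l' generalizing l with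
  | nil =>
    cases l with
    | nil => exact .nil
    | cons P l =>
      obtain ⟨hP, hl⟩ := List.forall_mem_cons.1 hl
      have hle : P * idealProd Λ l ≤ P :=
        (mul_le_mul_right (isTwoSidedGrIdeal_idealProd hΛ.isGrOrder hl).le P).trans hP.mul_le_right
      exact absurd (hP.le.antisymm (h.symm.trans_le hle)) hP.ne_self
  | cons P l' ih =>
    obtain ⟨hP, hl'⟩ := List.forall_mem_cons.1 hl'
    have hl'_ideal := isTwoSidedGrIdeal_idealProd hΛ.isGrOrder hl'
    have hle : idealProd Λ l ≤ P :=
      h.trans_le ((mul_le_mul_right hl'_ideal.le P).trans hP.mul_le_right)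
    have perm_erase := List.perm_cons_erase (hP.mem_of_idealProd_le hΛ.isGrOrder hl hle)
    have hl_erase : ∀ Q ∈ l.erase P, D.IsGrPrime Λ Q := fun Q hQ => hl Q (List.mem_of_mem_erase hQ)
    rw [idealProd_eq_of_perm hΛ hl perm_erase] at h
    have h' := hP.isGrFractionalIdeal.mul_left_cancel
      (isTwoSidedGrIdeal_idealProd hΛ.isGrOrder hl_erase).isGrFractionalIdeal
      hl'_ideal.isGrFractionalIdeal hΛ h
    exact perm_erase.trans ((ih hl_erase hl' h').cons P)

end Factorization

end CrystallineGradedRing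

theorem mainTheorem11_general {R K G A : Type*} [CommRing R] [IsNoetherianRing R]
    [Ring.KrullDimLE 1 R] [Field K] [Algebra R K] [IsFractionRing R K]
    [Group G] [Fintype G] [MulSemiringAction G R] [Ring A]
    (D : CrystallineGradedRing R K G A)
    (Λ : AddSubgroup A) (hΛ : D.IsGrMaximalOrder Λ) :
    (∀ M : AddSubgroup A, D.IsTwoSidedGrIdeal Λ M →
      M * latticeInv M = Λ ∧ latticeInv M * M = Λ ∧ latticeInv (latticeInv M) = M) ∧
    (∀ M : AddSubgroup A, D.IsTwoSidedGrIdeal Λ M →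
      ∃ l : List (AddSubgroup A), (∀ P ∈ l, D.IsGrPrime Λ P) ∧ idealProd Λ l = M ∧
        ∀ l' : List (AddSubgroup A), (∀ P ∈ l', D.IsGrPrime Λ P) → idealProd Λ l' = M →
          l'.Perm l) ∧
    (∀ P Q : AddSubgroup A, D.IsGrPrime Λ P → D.IsGrPrime Λ Q → P * Q = Q * P) := by
  refine ⟨fun M hM => ?_, fun M hM => ?_, fun P Q hP hQ => hP.mul_comm hQ hΛ⟩
  · have hM' := hM.isGrFractionalIdeal
    exact ⟨hM'.mul_latticeInv hΛ, hM'.latticeInv_mul hΛ, hM'.latticeInv_latticeInv hΛ⟩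
  · obtain ⟨l, hl, rfl⟩ := hM.exists_idealProd_eq hΛ
    exact ⟨l, hl, rfl, fun l' hl' h => CrystallineGradedRing.perm_of_idealProd_eq hΛ hl' hl h⟩

theorem mainTheorem11 {R K G A : Type*} [CommRing R] [IsDedekindDomain R]
    [Field K] [Algebra R K] [IsFractionRing R K]
    [Group G] [Fintype G] [MulSemiringAction G R] [Ring A]
    (D : CrystallineGradedRing R K G A)
    (Λ : AddSubgroup A) (hΛ : D.IsGrMaximalOrder Λ) :
    (∀ M : AddSubgroup A, D.IsTwoSidedGrIdeal Λ M →
      M * latticeInv M = Λ ∧ latticeInv M * M = Λ ∧ latticeInv (latticeInv M) = M) ∧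
    (∀ M : AddSubgroup A, D.IsTwoSidedGrIdeal Λ M →
      ∃ l : List (AddSubgroup A), (∀ P ∈ l, D.IsGrPrime Λ P) ∧ idealProd Λ l = M ∧
        ∀ l' : List (AddSubgroup A), (∀ P ∈ l', D.IsGrPrime Λ P) → idealProd Λ l' = M →
          l'.Perm l) ∧
    (∀ P Q : AddSubgroup A, D.IsGrPrime Λ P → D.IsGrPrime Λ Q → P * Q = Q * P) :=
  mainTheorem11_general D Λ hΛ
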